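/- A \emph{loop} is a set $B$ with a binary operation $+$ and an element $0$ such that $0+a=a+0=a$ for all $a\in B$, and such that for all $a,b\in B$ each of the equations $x+a=b$ and $a+y=b$ has a unique solution in $B$. A \emph{K-loop} is a loop such that, for all $a,b,c\in B$, $a+(b+(a+c))=(a+(b+a))+c$ and $-(a+b)=(-a)+(-b)$, where $-a$ denotes the inverse of $a$, i.e. the unique solution $y$ of $a+y=0$. A K-loop is \emph{uniquely 2-divisible} if $x\mapsto x+x$ is a bijection of it onto itself. A subset $X\subseteq B$ is a \emph{sub-K-loop} if it contains $0$, is closed under $+$, and contains the solutions of $x+a=b$ and of $a+y=b$ for all $a,b\in X$; it is then a K-loop for the induced operations. A subset $X\subseteq B$ is \emph{convex} if $s(x,y):=y+(-x+y)\in X$ for all $x,y\in X$. A complete first-order theory is \emph{$\omega$-stable} if for every model $M$, every countable $A\subseteq M$ and every $n$ there are only countably many complete $n$-types over $A$; a structure is $\omega$-stable if its complete theory is. \emph{Definable} means definable with parameters. \textbf{Proposition.} Let $B$ be a uniquely 2-divisible K-loop that carries an $\omega$-stable first-order structure in which its addition is definable (for instance, the pure structure $(B,+,0)$, when this is $\omega$-stable).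 1. A definable subset $X\subseteq B$ is a sub-K-loop if and only if $X$ is convex and $0\in X$. 2. Every definable sub-K-loop of $B$ is uniquely 2-divisible. -/

import Mathlib

open FirstOrder

universe u v w

/-- A loop, written additively: a two-sided neutral element `0`, and the equations `x + a = b`
and `a + y = b` each have a unique solution. -/
class AddLoop (B : Type*) extends AddZeroClass B where
  existsUnique_add_left : ∀ a b : B, ∃! x : B, x + a = b
  existsUnique_add_right : ∀ a b : B, ∃! y : B, a + y = b

/-- A K-loop: a loop with the Bol condition and the automorphic inverse property.
The inverse `-a` is the unique solution `y` of `a + y = 0`. -/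
class KLoop (B : Type*) extends AddLoop B, Neg B where
  add_neg_self : ∀ a : B, a + -a = 0
  bol : ∀ a b c : B, a + (b + (a + c)) = (a + (b + a)) + c
  neg_add_eq : ∀ a b : B, -(a + b) = -a + -b

/-- Unique 2-divisibility: `x ↦ x + x` is a bijection. -/
def UniquelyTwoDivisible (B : Type*) [Add B] : Prop :=
  Function.Bijective fun x : B => x + x

namespace KLoop

variable {B : Type*} [KLoop B]

/-- The point `s(x, y) = y + (-x + y)`, symmetric to `x` with respect to the centre `y`. -/
def symmetric (x y : B) : B := y + (-x + y)

/-- A subset is convex if it contains `s(x, y)` for all its points `x`, `y`. -/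
def IsConvex (X : Set B) : Prop := ∀ x ∈ X, ∀ y ∈ X, symmetric x y ∈ X

/-- A subset is a sub-K-loop if it contains `0`, is closed under addition, and contains the
solutions of the equations `x + a = b` and `a + y = b` for its elements `a`, `b`.
It is then a K-loop for the induced operations, see `IsSubKLoop.toKLoop`. -/
structure IsSubKLoop (X : Set B) : Prop where
  zero_mem : (0 : B) ∈ X
  add_mem : ∀ a ∈ X, ∀ b ∈ X, a + b ∈ X
  left_mem : ∀ a ∈ X, ∀ b ∈ X, ∀ x : B, x + a = b → x ∈ X
  right_mem : ∀ a ∈ X, ∀ b ∈ X, ∀ y : B, a + y = b → y ∈ X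

/-- The K-loop structure that a sub-K-loop inherits. -/
@[reducible] def IsSubKLoop.toKLoop {X : Set B} (h : IsSubKLoop X) : KLoop X where
  add a b := ⟨a.1 + b.1, h.add_mem a.1 a.2 b.1 b.2⟩
  zero := ⟨0, h.zero_mem⟩
  neg a := ⟨-a.1, h.right_mem a.1 a.2 0 h.zero_mem (-a.1) (add_neg_self a.1)⟩
  zero_add a := Subtype.ext (zero_add a.1)
  add_zero a := Subtype.ext (add_zero a.1)
  existsUnique_add_left a b := by
    obtain ⟨x, hx, hu⟩ := AddLoop.existsUnique_add_left a.1 b.1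
    exact ⟨⟨x, h.left_mem a.1 a.2 b.1 b.2 x hx⟩, Subtype.ext hx,
      fun y hy => Subtype.ext (hu y.1 (congrArg Subtype.val hy))⟩
  existsUnique_add_right a b := by
    obtain ⟨y, hy, hu⟩ := AddLoop.existsUnique_add_right a.1 b.1
    exact ⟨⟨y, h.right_mem a.1 a.2 b.1 b.2 y hy⟩, Subtype.ext hy,
      fun z hz => Subtype.ext (hu z.1 (congrArg Subtype.val hz))⟩
  add_neg_self a := Subtype.ext (add_neg_self a.1)
  bol a b c := Subtype.ext (bol a.1 b.1 c.1)
  neg_add_eq a b := Subtype.ext (neg_add_eq a.1 b.1)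

end KLoop

/-- A theory is ω-stable if over every countable parameter set `A` in a model `M` there are only
countably many complete `n`-types, for every `n`; the complete `n`-types over `A` are those of
the complete theory of `M` with constants for the elements of `A`. -/
def FirstOrder.Language.Theory.IsOmegaStable {L : Language.{u, v}} (T : L.Theory) : Prop :=
  ∀ (M : Type w) [L.Structure M] [Nonempty M] [M ⊨ T] (A : Set M), A.Countable →
    ∀ n : ℕ, Countable ((L[[A]].completeTheory M).CompleteType (Fin n))

/-- A structure is ω-stable if its complete theory is. -/
def FirstOrder.Language.IsOmegaStableStructure (L : Language.{u, v}) (B : Type w)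
    [L.Structure B] : Prop :=
  FirstOrder.Language.Theory.IsOmegaStable.{u, v, w} (L.completeTheory B)

/-- Addition is definable in the `L`-structure `B`, possibly with parameters. -/
def FirstOrder.Language.DefinableAdd (L : Language.{u, v}) (B : Type w) [L.Structure B]
    [Add B] : Prop :=
  (Set.univ : Set B).Definable L {t : Fin 3 → B | t 0 + t 1 = t 2}

/-!
Let `X` be a convex definable set containing `0`, and write `τ a` for the left translation
`x ↦ a + x`. The Bol condition says `τ (a + (b + a)) = τ a ∘ τ b ∘ τ a`, so the left translations by
elements of `X` are closed under inverses and under `(g, h) ↦ g h g`. Both claims reduce to the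
statement that `X` is closed under halving (`KLoop.exists_add_self_eq_of_isConvex`): in a K-loop
`(a + b) + (a + b) = a + ((b + b) + a)`, so closure under halving turns convexity into closure
under addition, and the solutions of linear equations are expressed by addition and inverses.

To halve `a ∈ X`, replace `X` by the definable set `Z` of those elements of `X` that commute, as left
translations, with `a` and with every element of `X` commuting with `a`
(`KLoop.bicommutant`). It is again convex, it contains `a`, and its left translations commute
pairwise. If `a` were not the double of an element of `Z`, then the two definable maps `x ↦ 4x`
and `x ↦ 2x + (a + 2x)` would be injections of `Z` into itself with disjoint images: equality
of values at `y` and `x` gives `τ a = (τ y)⁴ (τ x)⁻⁴`, which is the square of the left translation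
by `-x + (2y + -x) ∈ Z`.

Two such injections `f`, `g` of a nonempty set contradict ω-stability
(`IsOmegaStableStructure.not_exists_disjoint_definable_injections`): their iterates form a full
binary tree of definable sets, and the sets `D 0 = g '' Z`, `D (n + 1) = f '' D n ∪ g '' D n`, which
read off the binary digits of the position in the tree, form an independent sequence. By
compactness each subset of `ℕ` is then cut out by a complete type over a common countable set of
parameters, and there are uncountably many of these.
-/

open Set

/-! ### Independent sequences of definable sets and ω-stability -/

/-- In an ω-stable structure no sequence of definable sets is independent, that is, realizes every
`0`-`1` pattern on each initial segment. -/
theorem FirstOrder.Language.IsOmegaStableStructure.not_independent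
    {L : FirstOrder.Language.{u, v}} {B : Type w} [L.Structure B] [Nonempty B]
    (hst : L.IsOmegaStableStructure B) (D : ℕ → Set B)
    (hD : ∀ n, (univ : Set B).Definable₁ L (D n))
    (hind : ∀ (n : ℕ) (S : Set ℕ), ∃ x, ∀ i < n, (x ∈ D i ↔ i ∈ S)) : False := by
  -- Each `D n` needs only finitely many parameters, so countably many suffice for all of them.
  choose A₀ _ hA₀ using fun n => definable_iff_finitely_definable.1 (hD n)
  set A : Set B := ⋃ n, (A₀ n : Set B)
  have hA : A.Countable := countable_iUnion fun n => (A₀ n).countable_toSet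
  choose φ hφ using fun n => (hA₀ n).mono (subset_iUnion (fun n => (A₀ n : Set B)) n)
  have hφ' (n : ℕ) (x : B) : (φ n).Realize (fun _ : Fin 1 => x) ↔ x ∈ D n :=
    (Set.ext_iff.1 (hφ n) fun _ => x).symm
  let T := L[[A]].completeTheory B
  let C (S : Set ℕ) (n : ℕ) : Set (T.CompleteType (Fin 1)) :=
    {p | FirstOrder.Language.Formula.equivSentence (φ n) ∈ p ↔ n ∈ S}
  have hC (S : Set ℕ) (n : ℕ) : IsClosed (C S n) := by
    have h := CompleteType.isClopen_typesWith (T := T)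
      (FirstOrder.Language.Formula.equivSentence (φ n))
    by_cases hn : n ∈ S
    · simpa [C, hn] using! h.isClosed
    · have hCn : C S n = (T.typesWith (FirstOrder.Language.Formula.equivSentence (φ n)))ᶜ :=
        Set.ext fun q => by simp [C, hn]
      exact hCn ▸ h.compl.isClosed
  have hne (S : Set ℕ) : (⋂ n, C S n).Nonempty := by
    refine CompactSpace.iInter_nonempty (hC S) fun s => ?_
    obtain ⟨x, hx⟩ := hind (s.sup id + 1) S
    refine ⟨T.typeOf fun _ => x, mem_iInter₂.2 fun i hi => ?_⟩
    change _ ∈ _ ↔ _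
    rw [FirstOrder.Language.Theory.CompleteType.formula_mem_typeOf, hφ']
    exact hx i (Nat.lt_succ_of_le (Finset.le_sup (f := id) hi))
  choose p hp using hne
  have hinj : Function.Injective p := fun S S' h => Set.ext fun n => by
    rw [← (show _ ↔ n ∈ S from mem_iInter.1 (hp S) n), h]
    exact mem_iInter.1 (hp S') n
  have : Countable (T.CompleteType (Fin 1)) := hst B A hA 1
  have : Countable (Set ℕ) := hinj.countable
  obtain ⟨e, he⟩ := exists_injective_nat (Set ℕ)
  exact Function.cantor_injective e he

/-- Universal quantification over one element preserves definability. -/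
theorem Set.Definable.forall_elem {L : FirstOrder.Language.{u, v}} {B : Type w} [L.Structure B]
    {A : Set B} {α : Type*} {P : (α → B) → B → Prop}
    (h : A.Definable L {w : Option α → B | P (w ∘ some) (w none)}) :
    A.Definable L {x : α → B | ∀ z, P x z} := by
  convert! (h.preimage_comp (β := α ⊕ Unit) fun o => o.elim (Sum.inr ()) Sum.inl).forall_of_finite
    using 1
  ext x
  exact ⟨fun H u => H (u ()), fun H z => H fun _ => z⟩

/-- Existential quantification over one element preserves definability. -/
theorem Set.Definable.exists_elem {L : FirstOrder.Language.{u, v}} {B : Type w} [L.Structure B]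
    {A : Set B} {α : Type*} {P : (α → B) → B → Prop}
    (h : A.Definable L {w : Option α → B | P (w ∘ some) (w none)}) :
    A.Definable L {x : α → B | ∃ z, P x z} := by
  convert! (h.preimage_comp (β := α ⊕ Unit) fun o => o.elim (Sum.inr ()) Sum.inl).exists_of_finite
    using 1
  ext x
  exact ⟨fun ⟨z, H⟩ => ⟨fun _ => z, H⟩, fun ⟨u, H⟩ => ⟨u (), H⟩⟩

theorem Set.Definable₁.preimage {L : FirstOrder.Language.{u, v}} {B : Type w} [L.Structure B]
    {A X : Set B} {α : Type*} {f : (α → B) → B} (hX : A.Definable₁ L X)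
    (hf : A.DefinableFun L f) : A.Definable L {x | f x ∈ X} :=
  Set.Definable.preimage_map (F := fun x _ => f x) (fun _ => hf) hX

theorem Set.Definable₁.image {L : FirstOrder.Language.{u, v}} {B : Type w} [L.Structure B]
    {A X : Set B} {f : B → B} (hX : A.Definable₁ L X)
    (hf : A.DefinableFun L fun x : Fin 1 → B => f (x 0)) : A.Definable₁ L (f '' X) := by
  refine Set.Definable.exists_elem (P := fun x z => z ∈ X ∧ f z = x 0) (Set.Definable.inter ?_ ?_)
  · exact hX.preimage (DefinableFun.proj L)
  · exact DefinableFun.ofPred_eq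
      (DefinableFun.comp (g := fun w _ => w none) (fun _ => DefinableFun.proj L) hf)
      (DefinableFun.proj L)

/-- In an ω-stable structure a nonempty set does not admit two definable injections into itself with
disjoint images. -/
theorem FirstOrder.Language.IsOmegaStableStructure.not_exists_disjoint_definable_injections
    {L : FirstOrder.Language.{u, v}} {B : Type w} [L.Structure B] [Nonempty B]
    (hst : L.IsOmegaStableStructure B) {Z : Set B} (hZ : (univ : Set B).Definable₁ L Z)
    (hne : Z.Nonempty) {f g : B → B}
    (hf : (univ : Set B).DefinableFun L fun x : Fin 1 → B => f (x 0))
    (hg : (univ : Set B).DefinableFun L fun x : Fin 1 → B => g (x 0))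
    (hfZ : MapsTo f Z Z) (hgZ : MapsTo g Z Z) (hfi : InjOn f Z) (hgi : InjOn g Z)
    (hfg : ∀ x ∈ Z, ∀ y ∈ Z, f x ≠ g y) : False := by
  let D : ℕ → Set B := fun n => Nat.rec (g '' Z) (fun _ E => f '' E ∪ g '' E) n
  have hD (n : ℕ) : (univ : Set B).Definable₁ L (D n) := by
    induction n with
    | zero => exact hZ.image hg
    | succ n ih => exact (ih.image hf).union (ih.image hg)
  have hDZ (n : ℕ) : D n ⊆ Z := by
    induction n with
    | zero => exact hgZ.image_subset
    | succ n ih =>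
      exact union_subset ((image_mono ih).trans hfZ.image_subset)
        ((image_mono ih).trans hgZ.image_subset)
  have hfD (n : ℕ) {x : B} (hx : x ∈ Z) : f x ∈ D (n + 1) ↔ x ∈ D n := by
    refine ⟨?_, fun h => Or.inl ⟨x, h, rfl⟩⟩
    rintro (⟨y, hy, h⟩ | ⟨y, hy, h⟩)
    · exact hfi (hDZ n hy) hx h ▸ hy
    · exact (hfg x hx y (hDZ n hy) h.symm).elim
  have hgD (n : ℕ) {x : B} (hx : x ∈ Z) : g x ∈ D (n + 1) ↔ x ∈ D n := by
    refine ⟨?_, fun h => Or.inr ⟨x, h, rfl⟩⟩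
    rintro (⟨y, hy, h⟩ | ⟨y, hy, h⟩)
    · exact (hfg y (hDZ n hy) x hx h).elim
    · exact hgi (hDZ n hy) hx h ▸ hy
  have key (n : ℕ) : ∀ S : Set ℕ, ∃ x ∈ Z, ∀ i < n, (x ∈ D i ↔ i ∈ S) := by
    induction n with
    | zero => exact fun S => ⟨hne.some, hne.some_mem, fun i hi => absurd hi i.not_lt_zero⟩
    | succ n ih =>
      intro S
      obtain ⟨y, hy, H⟩ := ih {i | i + 1 ∈ S}
      by_cases h0 : 0 ∈ S
      · refine ⟨g y, hgZ hy, fun i hi => ?_⟩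
        rcases i with _ | i
        · exact iff_of_true ⟨y, hy, rfl⟩ h0
        · exact (hgD i hy).trans (H i (by omega))
      · refine ⟨f y, hfZ hy, fun i hi => ?_⟩
        rcases i with _ | i
        · exact iff_of_false (fun ⟨z, hz, h⟩ => hfg y hy z hz h.symm) h0
        · exact (hfD i hy).trans (H i (by omega))
  exact hst.not_independent D hD fun n S => (key n S).imp fun _ h => h.2

/-! ### K-loop arithmetic -/

namespace KLoop

variable {B : Type*} [KLoop B]

theorem add_left_cancel' {a b c : B} (h : a + b = a + c) : b = c :=
  (AddLoop.existsUnique_add_right a (a + c)).unique h rfl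

theorem add_right_cancel' {a b c : B} (h : b + a = c + a) : b = c :=
  (AddLoop.existsUnique_add_left a (c + a)).unique h rfl

theorem neg_add_self (a : B) : -a + a = 0 := by
  have h : a + (-a + a) = a := by
    refine add_right_cancel' (a := -a) ?_
    rw [← bol, add_neg_self, add_zero, add_neg_self]
  exact add_left_cancel' (h.trans (add_zero a).symm)

theorem neg_add_cancel_left (a b : B) : -a + (a + b) = b := by
  refine add_left_cancel' (a := a) ?_
  rw [bol, neg_add_self, add_zero]

theorem neg_neg' (a : B) : - -a = a := by
  refine add_left_cancel' (a := -a) ?_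
  rw [add_neg_self, neg_add_self]

theorem add_neg_cancel_left (a b : B) : a + (-a + b) = b := by
  simpa only [neg_neg'] using neg_add_cancel_left (-a) b

/-- Left alternativity: left translation by a double is the square of a left translation. -/
theorem add_self_add (a b : B) : (a + a) + b = a + (a + b) := by
  simpa only [zero_add] using (bol a 0 b).symm

/-- The solution `x` of `x + a = b` is `b + (-(b + a) + b)`. -/
theorem right_division (a b : B) : (b + (-(b + a) + b)) + a = b := by
  rw [← bol, neg_add_self, add_zero]

/-- Doubling a sum. Adding `-(a + b) = -a + -b` on the right turns both sides into `a + b`: the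
left one by left alternativity, the right one by the Bol condition. -/
theorem add_add_add_self (a b : B) : (a + b) + (a + b) = a + ((b + b) + a) := by
  refine add_right_cancel' (a := -(a + b)) ?_
  rw [add_self_add, add_neg_self, add_zero, neg_add_eq, ← bol, add_neg_cancel_left, add_self_add,
    add_neg_self, add_zero]

/-! ### Convex sets -/

namespace IsConvex

variable {X : Set B}

theorem neg_mem (hX : IsConvex X) (h0 : (0 : B) ∈ X) {a : B} (ha : a ∈ X) : -a ∈ X := by
  simpa only [symmetric, zero_add, add_zero] using hX a ha 0 h0

theorem add_add_mem (hX : IsConvex X) (h0 : (0 : B) ∈ X) {a b : B} (ha : a ∈ X) (hb : b ∈ X) :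
    a + (b + a) ∈ X := by
  simpa only [symmetric, neg_neg'] using hX (-b) (hX.neg_mem h0 hb) a ha

theorem add_self_mem (hX : IsConvex X) (h0 : (0 : B) ∈ X) {a : B} (ha : a ∈ X) : a + a ∈ X := by
  simpa only [zero_add] using hX.add_add_mem h0 ha h0

end IsConvex

theorem IsSubKLoop.neg_mem {X : Set B} (h : IsSubKLoop X) {a : B} (ha : a ∈ X) : -a ∈ X :=
  h.right_mem a ha 0 h.zero_mem _ (add_neg_self a)

theorem IsSubKLoop.isConvex {X : Set B} (h : IsSubKLoop X) : IsConvex X := fun _ hx y hy =>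
  h.add_mem y hy _ (h.add_mem _ (h.neg_mem hx) y hy)

/-- The left translations by `a` and `b` commute. -/
def TransCommute (a b : B) : Prop := ∀ z, a + (b + z) = b + (a + z)

theorem TransCommute.symm {a b : B} (h : TransCommute a b) : TransCommute b a :=
  fun z => (h z).symm

theorem TransCommute.neg_left {a b : B} (h : TransCommute a b) : TransCommute (-a) b := fun z => by
  refine add_left_cancel' (a := a) ?_
  rw [add_neg_cancel_left, h, add_neg_cancel_left]

theorem TransCommute.add_add_left {a b c : B} (ha : TransCommute a c) (hb : TransCommute b c) :
    TransCommute (a + (b + a)) c := fun z => by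
  rw [← bol, ← bol, ha z, hb, ha]

theorem TransCommute.symmetric_left {x y c : B} (hx : TransCommute x c) (hy : TransCommute y c) :
    TransCommute (symmetric x y) c := hy.add_add_left hx.neg_left

theorem transCommute_zero_left (c : B) : TransCommute 0 c := fun z => by
  rw [zero_add, zero_add]

/-- The elements of `X` whose left translations commute with that of `a` and with those of all
elements of `X` commuting with `a`. -/
def bicommutant (X : Set B) (a : B) : Set B :=
  {b | b ∈ X ∧ TransCommute b a ∧ ∀ c, c ∈ X → TransCommute c a → TransCommute b c}

theorem bicommutant_isConvex {X : Set B} (hX : IsConvex X) (a : B) : IsConvex (bicommutant X a) :=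
  fun x hx y hy => ⟨hX x hx.1 y hy.1, hx.2.1.symmetric_left hy.2.1,
    fun c hc hca => (hx.2.2 c hc hca).symmetric_left (hy.2.2 c hc hca)⟩

theorem zero_mem_bicommutant {X : Set B} (h0 : (0 : B) ∈ X) (a : B) : (0 : B) ∈ bicommutant X a :=
  ⟨h0, transCommute_zero_left a, fun c _ _ => transCommute_zero_left c⟩

theorem self_mem_bicommutant {X : Set B} {a : B} (ha : a ∈ X) : a ∈ bicommutant X a :=
  ⟨ha, fun _ => rfl, fun _ _ h => h.symm⟩

theorem transCommute_of_mem_bicommutant {X : Set B} {a b c : B} (hb : b ∈ bicommutant X a)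
    (hc : c ∈ bicommutant X a) : TransCommute b c :=
  hb.2.2 c hc.1 hc.2.1

/-- If `4y = 2x + (a + 2x)` for elements with commuting left translations, then `a` is the
double of `-x + (2y + -x)`. -/
theorem add_self_eq_of_quadruple_eq {a x y : B} (hxy : TransCommute x y)
    (hxa : TransCommute x a) (h : (y + y) + (y + y) = (x + x) + (a + (x + x))) :
    (-x + ((y + y) + -x)) + (-x + ((y + y) + -x)) = a := by
  have hyx : TransCommute y (-x) := hxy.neg_left.symm
  have h4 (z : B) : y + (y + (y + (y + z))) = x + (x + (x + (x + (a + z)))) := by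
    have : ((y + y) + (y + y)) + z = ((x + x) + (a + (x + x))) + z := congrArg (· + z) h
    rwa [add_self_add (y + y), add_self_add y, add_self_add y, ← bol, add_self_add x,
      add_self_add x, ← hxa, ← hxa] at this
  have hw (z : B) : (-x + ((y + y) + -x)) + z = -x + (-x + (y + (y + z))) := by
    rw [← bol, add_self_add, hyx, hyx]
  have e (z : B) : y + (y + (-x + (-x + z))) = -x + (-x + (y + (y + z))) := by
    rw [hyx, hyx, hyx, hyx]
  rw [← add_zero ((-x + ((y + y) + -x)) + (-x + ((y + y) + -x))), add_self_add, hw, hw, e, h4]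
  simp only [neg_add_cancel_left, add_zero]

/-! ### Halving in definable convex sets -/

section Definable

variable {L : FirstOrder.Language.{u, v}} {B : Type w} [KLoop B] [L.Structure B]

theorem definableFun_add (hadd : L.DefinableAdd B) {α : Type*} {f g : (α → B) → B}
    (hf : (univ : Set B).DefinableFun L f) (hg : (univ : Set B).DefinableFun L g) :
    (univ : Set B).DefinableFun L fun x => f x + g x := by
  have h2 : (univ : Set B).DefinableFun L fun x : Fin 2 → B => x 0 + x 1 :=
    hadd.preimage_comp (β := Option (Fin 2)) ![some 0, some 1, none]
  exact DefinableFun.comp (g := fun x => ![f x, g x])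
    (fun i => by fin_cases i; exacts [hf, hg]) h2

theorem definable_transCommute (hadd : L.DefinableAdd B) {α : Type*} {f g : (α → B) → B}
    (hf : (univ : Set B).DefinableFun L f) (hg : (univ : Set B).DefinableFun L g) :
    (univ : Set B).Definable L {x | TransCommute (f x) (g x)} := by
  have h2 : (univ : Set B).Definable L {x : Fin 2 → B | TransCommute (x 0) (x 1)} := by
    refine Set.Definable.forall_elem (DefinableFun.ofPred_eq ?_ ?_) <;>
      exact definableFun_add hadd (DefinableFun.proj L)
        (definableFun_add hadd (DefinableFun.proj L) (DefinableFun.proj L))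
  exact Set.Definable.preimage_map (F := fun x => ![f x, g x])
    (fun i => by fin_cases i; exacts [hf, hg]) h2

theorem definable_bicommutant (hadd : L.DefinableAdd B) {X : Set B}
    (hX : (univ : Set B).Definable₁ L X) (a : B) :
    (univ : Set B).Definable₁ L (bicommutant X a) := by
  have hc (γ : Type) : (univ : Set B).DefinableFun L fun _ : γ → B => a :=
    L.definableFun_const γ (mem_univ a)
  refine Set.Definable.inter hX (Set.Definable.inter ?_ ?_)
  · exact definable_transCommute hadd (DefinableFun.proj L) (hc _)
  · refine Set.Definable.forall_elem (α := Fin 1)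
      (P := fun x c => c ∈ X → TransCommute c a → TransCommute (x 0) c) ?_
    have h1 := hX.preimage (DefinableFun.proj L (α := Option (Fin 1)) (i := none))
    have h2 := definable_transCommute hadd
      (DefinableFun.proj L (α := Option (Fin 1)) (i := none)) (hc _)
    have h3 := definable_transCommute hadd
      (DefinableFun.proj L (A := (univ : Set B)) (i := some (0 : Fin 1)))
      (DefinableFun.proj L (i := none))
    convert! h1.himp (h2.himp h3) using 1

/-- A definable convex set containing `0` is closed under halving. -/
theorem exists_add_self_eq_of_isConvex (hadd : L.DefinableAdd B) (hdiv : UniquelyTwoDivisible B)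
    (hst : L.IsOmegaStableStructure B) {X : Set B} (hX : (univ : Set B).Definable₁ L X)
    (hconv : IsConvex X) (h0 : (0 : B) ∈ X) {a : B} (ha : a ∈ X) : ∃ b ∈ X, b + b = a := by
  by_contra! hne
  have hZ := definable_bicommutant hadd hX a
  have hZc := bicommutant_isConvex hconv a
  have hZ0 := zero_mem_bicommutant h0 a
  have haZ := self_mem_bicommutant ha
  set Z := bicommutant X a
  have hcomm {b c : B} (hb : b ∈ Z) (hc : c ∈ Z) : TransCommute b c :=
    transCommute_of_mem_bicommutant hb hc
  have : Nonempty B := ⟨0⟩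
  have hinj {x y : B} (h : (x + x) + (x + x) = (y + y) + (y + y)) : x = y :=
    hdiv.1 (hdiv.1 h)
  have hdbl : (univ : Set B).DefinableFun L fun x : Fin 1 → B => x 0 + x 0 :=
    definableFun_add hadd (DefinableFun.proj L) (DefinableFun.proj L)
  refine hst.not_exists_disjoint_definable_injections hZ ⟨0, hZ0⟩
    (f := fun x => (x + x) + (x + x)) (g := fun x => (x + x) + (a + (x + x)))
    (definableFun_add hadd hdbl hdbl)
    (definableFun_add hadd hdbl
      (definableFun_add hadd (L.definableFun_const _ (mem_univ a)) hdbl))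
    (fun x hx => hZc.add_self_mem hZ0 (hZc.add_self_mem hZ0 hx))
    (fun x hx => hZc.add_add_mem hZ0 (hZc.add_self_mem hZ0 hx) haZ)
    (fun x _ y _ h => hinj h) ?_ ?_
  · intro x hx y hy h
    -- Moving `a` to the front turns both sides into `a + 4x` and `a + 4y`.
    have e {z : B} (hz : z ∈ Z) :
        (z + z) + (a + (z + z)) = a + ((z + z) + (z + z)) := by
      simp only [add_self_add]
      rw [hcomm hz haZ, hcomm hz haZ]
    refine hinj (add_left_cancel' (a := a) ?_)
    rw [← e hx, ← e hy]
    exact h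
  · intro y hy x hx h
    refine hne (-x + ((y + y) + -x)) (hconv.add_add_mem h0 (hconv.neg_mem h0 hx.1)
      (hconv.add_self_mem h0 hy.1)) ?_
    exact add_self_eq_of_quadruple_eq (hcomm hx hy) (hcomm hx haZ) h

theorem isSubKLoop_of_isConvex (hadd : L.DefinableAdd B) (hdiv : UniquelyTwoDivisible B)
    (hst : L.IsOmegaStableStructure B) {X : Set B} (hX : (univ : Set B).Definable₁ L X)
    (hconv : IsConvex X) (h0 : (0 : B) ∈ X) : IsSubKLoop X := by
  have hsum : ∀ a ∈ X, ∀ b ∈ X, a + b ∈ X := fun a ha b hb => by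
    obtain ⟨c, hc, h⟩ := exists_add_self_eq_of_isConvex hadd hdiv hst hX hconv h0
      (hconv.add_add_mem h0 ha (hconv.add_self_mem h0 hb))
    exact hdiv.1 (h.trans (add_add_add_self a b).symm) ▸ hc
  refine ⟨h0, hsum, fun a ha b hb x hx => ?_, fun a ha b hb y hy => ?_⟩
  · rw [add_right_cancel' (hx.trans (right_division a b).symm)]
    exact hconv.add_add_mem h0 hb (hconv.neg_mem h0 (hsum b hb a ha))
  · rw [← neg_add_cancel_left a y, hy]
    exact hsum _ (hconv.neg_mem h0 ha) b hb

end Definable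

end KLoop

theorem mainTheorem7 (L : FirstOrder.Language.{u, v}) (B : Type w) [KLoop B] [L.Structure B]
    (hadd : L.DefinableAdd B) (hdiv : UniquelyTwoDivisible B)
    (hstable : L.IsOmegaStableStructure B) :
    (∀ X : Set B, (Set.univ : Set B).Definable₁ L X →
      (KLoop.IsSubKLoop X ↔ KLoop.IsConvex X ∧ (0 : B) ∈ X)) ∧
    (∀ X : Set B, (Set.univ : Set B).Definable₁ L X → ∀ h : KLoop.IsSubKLoop X,
      @UniquelyTwoDivisible X h.toKLoop.toAdd) := by
  refine ⟨fun X hX => ⟨fun h => ⟨h.isConvex, h.zero_mem⟩, fun h =>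
    KLoop.isSubKLoop_of_isConvex hadd hdiv hstable hX h.1 h.2⟩, fun X hX h => ⟨?_, ?_⟩⟩
  · exact fun x y hxy => Subtype.ext (hdiv.1 (congrArg Subtype.val hxy))
  · intro a
    obtain ⟨b, hb, hab⟩ := KLoop.exists_add_self_eq_of_isConvex hadd hdiv hstable hX h.isConvex
      h.zero_mem a.2
    exact ⟨⟨b, hb⟩, Subtype.ext hab⟩
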